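/- All graphs are finite, simple and undirected. A graph $G$ on at least $2k$ vertices is $k$-path-pairable if for any two disjoint sets $\{x_1,\dots,x_k\}$ and $\{y_1,\dots,y_k\}$ of distinct vertices of $G$ there exist pairwise edge-disjoint paths $P_1,\dots,P_k$ in $G$ such that $P_i$ joins $x_i$ to $y_i$ for $1\le i\le k$. A $k$-path-pairable graph on $2k$ or $2k+1$ vertices is called path-pairable. For integers $n, m\ge 0$ let $d(n,\mathcal{G}_m)$ denote the maximum diameter of a path-pairable graph with exactly $n$ vertices and at most $m$ edges. **Theorem.** If $2n\le m\le \frac14 n^{3/2}$, then this maximum exists and is finite, and $$\sqrt[3]{\tfrac12 m-n}\;\le\; d(n,\mathcal{G}_m)\;\le\; 16\sqrt[3]{m}.$$ -/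

import Mathlib

/-- A finite simple graph `G` is `k`-path-pairable if it has at least `2k` vertices and, for any
disjoint sets `{x₁, …, x_k}` and `{y₁, …, y_k}` of distinct vertices, there are pairwise
edge-disjoint paths `P₁, …, P_k` in `G` such that `P_i` joins `x_i` to `y_i`. -/
def IsKPathPairable {V : Type*} [Fintype V] (G : SimpleGraph V) (k : ℕ) : Prop :=
  2 * k ≤ Fintype.card V ∧
    ∀ x y : Fin k → V, Function.Injective x → Function.Injective y →
      Disjoint (Set.range x) (Set.range y) →
        ∃ P : ∀ i : Fin k, G.Path (x i) (y i),
          ∀ i j : Fin k, i ≠ j →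
            List.Disjoint (P i : G.Walk (x i) (y i)).edges (P j : G.Walk (x j) (y j)).edges

/-- A graph is path-pairable if it is `k`-path-pairable and has `2k` or `2k + 1` vertices. -/
def IsPathPairable {V : Type*} [Fintype V] (G : SimpleGraph V) : Prop :=
  ∃ k : ℕ, (Fintype.card V = 2 * k ∨ Fintype.card V = 2 * k + 1) ∧ IsKPathPairable G k

/-- The (labelled) graphs on `n` vertices with at most `m` edges. -/
def graphsWithAtMostEdges (n m : ℕ) : Set (SimpleGraph (Fin n)) :=
  {G | G.edgeSet.ncard ≤ m}

/-- The set of diameters of the path-pairable graphs belonging to a family `𝒢` of graphs on `n`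
vertices. Diameters are taken in `ℕ∞`, so that a disconnected graph has diameter `⊤`. -/
def pathPairableDiameters (n : ℕ) (𝒢 : Set (SimpleGraph (Fin n))) : Set ℕ∞ :=
  {d | ∃ G ∈ 𝒢, IsPathPairable G ∧ G.ediam = d}

/-- `IsMaxDiameter n 𝒢 d` says that `d` is the maximum diameter of a path-pairable graph on `n`
vertices in `𝒢`: the maximum exists, is finite, and equals `d`. -/
def IsMaxDiameter (n : ℕ) (𝒢 : Set (SimpleGraph (Fin n))) (d : ℕ) : Prop :=
  IsGreatest (pathPairableDiameters n 𝒢) (d : ℕ∞)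

/-!
For the upper bound, let `G` be `k`-path-pairable on `2k` or `2k + 1` vertices. Pairing the
vertices of a set `S` with `|S| ≤ k` with vertices outside it shows that at least `|S|` edges leave
`S`. Apply this to the balls about a vertex `u`. The edges leaving the ball of radius `i` run
between the spheres of radius `i` and `i + 1`, so the product of the sizes of these spheres is at
least the size of the ball. Hence balls with at most `k` vertices grow quadratically in the radius
(`IsKPathPairable.sq_le_card_graphBall`). The edges leaving balls of different radii are
distinct, so summing over the radii `i < M` gives at least `M ^ 3 / 48` edges
(`IsKPathPairable.cube_le_edges`). If `u` and `v` are at distance `d`, then their balls of radius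
`(d - 1) / 2` are disjoint, hence one of them has at most `k` vertices, and `d ^ 3 ≤ 384 m`
(`IsPathPairable.dist_cube_le`).

For the lower bound, `hubGraph q f` has a tail of `q + 1` layers of `q + 1` vertices each. Every
tail vertex owns a path through the remaining layers to a private port, and these paths are
edge-disjoint: the path of a vertex of layer `i` advances by `i` modulo `q + 1` in each step, so
that every edge of the tail reveals its owner. The ports are adjacent to three hubs, the remaining
vertices to two. A demand is served by routing both of its ends to a common hub, and the only
obstruction is that a tail vertex and its port must use different hubs. So the hubs form a list
colouring of a conflict graph between the demands, in which every vertex has more admissible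
colours than neighbours, and a greedy choice succeeds (`isKPathPairable_of_routes`). With
`r = q + 1` and `n` vertices, the graph has `2n + r ^ 3 - r ^ 2 - 3` edges, and the first layer is
at distance `r + 1` from the hubs. The number `r` is chosen in `exists_number_of_layers`.
-/

/-! ### The cut condition and connectedness -/

/-- Ordered pairs of adjacent vertices whose first entry lies in `S` and whose second does not. -/
noncomputable def boundaryPairs {V : Type*} [Fintype V] (G : SimpleGraph V) (S : Finset V) :
    Finset (V × V) := by
  classical
  exact Finset.univ.filter fun e => G.Adj e.1 e.2 ∧ e.1 ∈ S ∧ e.2 ∉ S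

theorem mem_boundaryPairs {V : Type*} [Fintype V] {G : SimpleGraph V} {S : Finset V}
    {e : V × V} : e ∈ boundaryPairs G S ↔ G.Adj e.1 e.2 ∧ e.1 ∈ S ∧ e.2 ∉ S := by
  simp [boundaryPairs]

/-- Linking a set containing `S` to a set outside it sends `|S|` edge-disjoint paths across the
boundary of `S`. -/
theorem IsKPathPairable.card_le_card_boundaryPairs {V : Type*} [Fintype V] {G : SimpleGraph V}
    {k : ℕ} (hG : IsKPathPairable G k) {S : Finset V} (hS : S.card ≤ k) :
    S.card ≤ (boundaryPairs G S).card := by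
  classical
  obtain ⟨hn, hP⟩ := hG
  obtain ⟨X, hSX, -, hX⟩ := Finset.exists_subsuperset_card_eq (Finset.subset_univ S) hS
    (by rw [Finset.card_univ]; omega)
  have hXc : k ≤ Xᶜ.card := by rw [Finset.card_compl]; omega
  obtain ⟨Y, hYX, hY⟩ := Finset.exists_subset_card_eq hXc
  let x : Fin k → V := fun i => ((X.equivFinOfCardEq hX).symm i : V)
  let y : Fin k → V := fun i => ((Y.equivFinOfCardEq hY).symm i : V)
  have hx : Function.Injective x := Subtype.val_injective.comp (Equiv.injective _)
  have hy : Function.Injective y := Subtype.val_injective.comp (Equiv.injective _)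
  have hyX : ∀ i, y i ∉ X := fun i =>
    Finset.mem_compl.mp (hYX ((Y.equivFinOfCardEq hY).symm i).2)
  have hxX : ∀ i, x i ∈ X := fun i => ((X.equivFinOfCardEq hX).symm i).2
  obtain ⟨P, hdisj⟩ := hP x y hx hy (by
    rw [Set.disjoint_left]
    rintro _ ⟨i, rfl⟩ ⟨j, hj⟩
    exact hyX j (hj ▸ hxX i))
  have hcross : ∀ i, ∃ e : V × V, x i ∈ S →
      s(e.1, e.2) ∈ (P i : G.Walk (x i) (y i)).edges ∧ e ∈ boundaryPairs G S := by
    intro i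
    by_cases hi : x i ∈ S
    · obtain ⟨d, hd, h1, h2⟩ := (P i : G.Walk (x i) (y i)).exists_boundary_dart (S : Set V) hi
        (fun h => hyX i (hSX h))
      exact ⟨d.toProd, fun _ => ⟨List.mem_map_of_mem hd, mem_boundaryPairs.2 ⟨d.adj, h1, h2⟩⟩⟩
    · exact ⟨(x i, x i), fun h => absurd h hi⟩
  choose d hd using hcross
  have hSx : S = (Finset.univ.filter fun i => x i ∈ S).image x := by
    ext v
    simp only [Finset.mem_image, Finset.mem_filter, Finset.mem_univ, true_and]
    constructor
    · intro hv
      refine ⟨X.equivFinOfCardEq hX ⟨v, hSX hv⟩, ?_⟩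
      simp [x, hv]
    · rintro ⟨i, hi, rfl⟩
      exact hi
  calc S.card ≤ (Finset.univ.filter fun i => x i ∈ S).card := by
        conv_lhs => rw [hSx]
        exact Finset.card_image_le
    _ ≤ _ := by
        refine Finset.card_le_card_of_injOn d ?_ ?_
        · intro i hi
          exact (hd i (by simpa using hi)).2
        · intro i hi j hj hij
          by_contra hne
          exact hdisj i j hne (hd i (by simpa using hi)).1
            (hij ▸ (hd j (by simpa using hj)).1)

theorem IsPathPairable.preconnected {V : Type*} [Fintype V] {G : SimpleGraph V}
    (hG : IsPathPairable G) : G.Preconnected := by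
  classical
  obtain ⟨k, hn, hk⟩ := hG
  intro u v
  by_contra huv
  -- Either the component of `u` or its complement has at most `k` vertices, and no boundary.
  let S : Finset V := Finset.univ.filter (G.Reachable u)
  have hcard : S.card + Sᶜ.card = Fintype.card V := Finset.card_add_card_compl S
  have hS : ∀ a b, G.Adj a b → (a ∈ S ↔ b ∈ S) := fun a b hab => by
    simp only [S, Finset.mem_filter, Finset.mem_univ, true_and]
    exact ⟨fun h => h.trans hab.reachable, fun h => h.trans hab.symm.reachable⟩
  have key : ∀ T : Finset V, (∀ a b, G.Adj a b → (a ∈ T ↔ b ∈ T)) → T.Nonempty → k < T.card := by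
    intro T hT hne
    by_contra! hle
    have h0 : boundaryPairs G T = ∅ := by
      ext e
      simp only [mem_boundaryPairs, Finset.notMem_empty, iff_false, not_and, not_not]
      exact fun he h => (hT _ _ he).1 h
    have := hk.card_le_card_boundaryPairs hle
    rw [h0, Finset.card_empty] at this
    exact absurd (Finset.card_pos.2 hne) (by omega)
  have h1 := key S hS ⟨u, by simp [S]⟩
  have h2 := key Sᶜ (fun a b hab => by simpa using not_congr (hS a b hab)) ⟨v, by simpa [S] using huv⟩
  omega

/-! ### Growth of balls and the upper bound on distances -/

/-- The closed ball of radius `i` about `u` in the graph metric. -/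
noncomputable def graphBall {V : Type*} [Fintype V] (G : SimpleGraph V) (u : V) (i : ℕ) :
    Finset V := Finset.univ.filter fun w => G.dist u w ≤ i

/-- The sphere of radius `i` about `u` in the graph metric. -/
noncomputable def graphSphere {V : Type*} [Fintype V] (G : SimpleGraph V) (u : V) (i : ℕ) :
    Finset V := Finset.univ.filter fun w => G.dist u w = i

theorem card_graphBall_succ {V : Type*} [Fintype V] (G : SimpleGraph V) (u : V) (i : ℕ) :
    (graphBall G u (i + 1)).card = (graphBall G u i).card + (graphSphere G u (i + 1)).card := by
  classical
  rw [← Finset.card_union_of_disjoint]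
  · congr 1
    ext w
    simp only [graphBall, graphSphere, Finset.mem_union, Finset.mem_filter, Finset.mem_univ,
      true_and]
    omega
  · rw [Finset.disjoint_left]
    intro w
    simp only [graphBall, graphSphere, Finset.mem_filter, Finset.mem_univ, true_and]
    omega

theorem card_graphBall_zero {V : Type*} [Fintype V] (G : SimpleGraph V) (u : V) :
    (graphBall G u 0).card = (graphSphere G u 0).card := by
  simp only [graphBall, graphSphere, Nat.le_zero]

theorem dist_of_mem_boundaryPairs_graphBall {V : Type*} [Fintype V] {G : SimpleGraph V}
    (hG : G.Connected) {u : V} {i : ℕ} {e : V × V} (he : e ∈ boundaryPairs G (graphBall G u i)) :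
    G.dist u e.1 = i ∧ G.dist u e.2 = i + 1 := by
  obtain ⟨hadj, h1, h2⟩ := mem_boundaryPairs.1 he
  simp only [graphBall, Finset.mem_filter, Finset.mem_univ, true_and] at h1 h2
  have h3 := hG.dist_triangle (u := u) (v := e.1) (w := e.2)
  rw [SimpleGraph.dist_eq_one_iff_adj.2 hadj] at h3
  omega

theorem card_boundaryPairs_graphBall_le {V : Type*} [Fintype V] {G : SimpleGraph V}
    (hG : G.Connected) (u : V) (i : ℕ) :
    (boundaryPairs G (graphBall G u i)).card ≤
      (graphSphere G u i).card * (graphSphere G u (i + 1)).card := by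
  rw [← Finset.card_product]
  refine Finset.card_le_card fun e he => ?_
  simpa [graphSphere] using dist_of_mem_boundaryPairs_graphBall hG he

/-- The boundaries of the balls about a vertex consist of distinct edges. -/
theorem sum_card_boundaryPairs_graphBall_le {V : Type*} [Fintype V] {G : SimpleGraph V}
    (hG : G.Connected) (u : V) (M : ℕ) :
    ∑ i ∈ Finset.range M, (boundaryPairs G (graphBall G u i)).card ≤ G.edgeSet.ncard := by
  classical
  rw [← Finset.card_sigma, ← Set.ncard_coe_finset]
  refine Set.ncard_le_ncard_of_injOn (fun z => s(z.2.1, z.2.2)) ?_ ?_ (Set.toFinite _)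
  · rintro ⟨i, e⟩ he
    simp only [Finset.coe_sigma, Set.mem_sigma_iff, Finset.mem_coe] at he
    exact (mem_boundaryPairs.1 he.2).1
  · rintro ⟨i, a, b⟩ he ⟨j, a', b'⟩ he' h
    simp only [Finset.coe_sigma, Set.mem_sigma_iff, Finset.mem_coe] at he he'
    have h1 := dist_of_mem_boundaryPairs_graphBall hG he.2
    have h2 := dist_of_mem_boundaryPairs_graphBall hG he'.2
    simp only [Sym2.eq_iff] at h h1 h2
    rcases h with ⟨rfl, rfl⟩ | ⟨rfl, rfl⟩
    · obtain rfl : i = j := by omega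
      rfl
    · omega

/-- As long as the balls contain at most `k` vertices, they grow at least quadratically: the
product of two consecutive sphere sizes is at least the size of the ball inside, so that, by the
inequality of arithmetic and geometric means, the two spheres together have size at least twice
its square root. -/
theorem IsKPathPairable.sq_le_card_graphBall {V : Type*} [Fintype V] {G : SimpleGraph V}
    {k : ℕ} (hG : IsKPathPairable G k) (hc : G.Connected) (u : V) {M : ℕ}
    (hM : ∀ i < M, (graphBall G u i).card ≤ k) :
    ∀ i < M, (i + 1) ^ 2 ≤ 16 * (graphBall G u i).card := by
  have h0 : 0 < (graphSphere G u 0).card := Finset.card_pos.2 ⟨u, by simp [graphSphere]⟩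
  have hprod : ∀ i < M, (graphBall G u i).card ≤
      (graphSphere G u i).card * (graphSphere G u (i + 1)).card := fun i hi =>
    (hG.card_le_card_boundaryPairs (hM i hi)).trans (card_boundaryPairs_graphBall_le hc u i)
  have hz := card_graphBall_zero G u
  intro i
  induction i using Nat.twoStepInduction with
  | zero => intro _; omega
  | one =>
    intro hi
    have h1 := hprod 0 (by omega)
    have h2 := card_graphBall_succ G u 0
    have h3 : 0 < (graphSphere G u 1).card := by
      rw [zero_add] at h1
      by_contra! h
      rw [Nat.le_zero.1 h, mul_zero] at h1
      omega
    rw [zero_add] at h2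
    omega
  | more i ih _ =>
    intro hi
    have h1 := hprod (i + 1) (by omega)
    have h2 := card_graphBall_succ G u i
    have h3 := card_graphBall_succ G u (i + 1)
    have h4 := ih (by omega)
    rw [show i + 1 + 1 = i + 2 from rfl] at h1 h3
    generalize (graphBall G u i).card = A at *
    generalize (graphBall G u (i + 1)).card = B at *
    generalize (graphBall G u (i + 2)).card = C at *
    generalize (graphSphere G u (i + 1)).card = s at *
    generalize (graphSphere G u (i + 2)).card = t at *
    have h5 : 4 * A ≤ (s + t) ^ 2 := by
      zify at *
      nlinarith [sq_nonneg ((s : ℤ) - t)]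
    have h6 : i + 1 ≤ 2 * (s + t) := by
      by_contra! h
      nlinarith
    nlinarith

theorem cube_le_three_mul_sum_sq (M : ℕ) : M ^ 3 ≤ 3 * ∑ i ∈ Finset.range M, (i + 1) ^ 2 := by
  induction M with
  | zero => simp
  | succ M ih =>
    rw [Finset.sum_range_succ, mul_add]
    calc (M + 1) ^ 3 ≤ (M + 1) ^ 3 + (3 * M + 2) := Nat.le_add_right _ _
      _ = M ^ 3 + 3 * (M + 1) ^ 2 := by ring
      _ ≤ _ := Nat.add_le_add_right ih _

theorem IsKPathPairable.cube_le_edges {V : Type*} [Fintype V] {G : SimpleGraph V}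
    {k : ℕ} (hG : IsKPathPairable G k) (hc : G.Connected) (u : V) {M : ℕ}
    (hM : ∀ i < M, (graphBall G u i).card ≤ k) : M ^ 3 ≤ 48 * G.edgeSet.ncard := by
  calc M ^ 3 ≤ 3 * ∑ i ∈ Finset.range M, (i + 1) ^ 2 := cube_le_three_mul_sum_sq M
    _ ≤ 3 * ∑ i ∈ Finset.range M, 16 * (boundaryPairs G (graphBall G u i)).card := by
        gcongr with i hi
        have hi := Finset.mem_range.1 hi
        have := hG.sq_le_card_graphBall hc u hM i hi
        have := hG.card_le_card_boundaryPairs (hM i hi)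
        omega
    _ = 48 * ∑ i ∈ Finset.range M, (boundaryPairs G (graphBall G u i)).card := by
        rw [← Finset.mul_sum]; ring
    _ ≤ _ := Nat.mul_le_mul_left _ (sum_card_boundaryPairs_graphBall_le hc u M)

theorem IsPathPairable.dist_cube_le {V : Type*} [Fintype V] {G : SimpleGraph V}
    (hG : IsPathPairable G) (u v : V) : G.dist u v ^ 3 ≤ 384 * G.edgeSet.ncard := by
  classical
  have hc : G.Connected := (G.connected_iff).2 ⟨hG.preconnected, ⟨u⟩⟩
  obtain ⟨k, hn, hk⟩ := hG
  rcases Nat.eq_zero_or_pos (G.dist u v) with h0 | hpos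
  · simp [h0]
  set d := G.dist u v with hd
  have hmono : ∀ w, ∀ i < (d + 1) / 2,
      (graphBall G w i).card ≤ (graphBall G w ((d - 1) / 2)).card := fun w i hi =>
    Finset.card_le_card fun z hz => by
      simp only [graphBall, Finset.mem_filter, Finset.mem_univ, true_and] at hz ⊢
      omega
  -- The balls of radius `(d - 1) / 2` about `u` and `v` are disjoint, so one of them is small.
  have hdisj : Disjoint (graphBall G u ((d - 1) / 2)) (graphBall G v ((d - 1) / 2)) := by
    rw [Finset.disjoint_left]
    intro w hu hv
    simp only [graphBall, Finset.mem_filter, Finset.mem_univ, true_and] at hu hv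
    have := hc.dist_triangle (u := u) (v := w) (w := v)
    rw [SimpleGraph.dist_comm (u := w)] at this
    omega
  have hsum := Finset.card_le_univ
    (graphBall G u ((d - 1) / 2) ∪ graphBall G v ((d - 1) / 2))
  rw [Finset.card_union_of_disjoint hdisj] at hsum
  have hcube : ((d + 1) / 2) ^ 3 ≤ 48 * G.edgeSet.ncard := by
    by_cases hu : (graphBall G u ((d - 1) / 2)).card ≤ k
    · exact hk.cube_le_edges hc u fun i hi => (hmono u i hi).trans hu
    · exact hk.cube_le_edges hc v fun i hi => (hmono v i hi).trans (by omega)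
  calc d ^ 3 ≤ (2 * ((d + 1) / 2)) ^ 3 := Nat.pow_le_pow_left (by omega) 3
    _ = 8 * ((d + 1) / 2) ^ 3 := by ring
    _ ≤ _ := by omega

/-! ### Path-pairability from routes to three hubs -/

/-- Greedy list colouring of a finite graph in which every vertex has more admissible colours than
neighbours. -/
theorem exists_list_coloring {ι C : Type*} [Fintype ι] [DecidableEq C] (H : SimpleGraph ι)
    [DecidableRel H.Adj] (L : ι → Finset C)
    (hL : ∀ i, (Finset.univ.filter fun j => H.Adj i j).card < (L i).card) :
    ∃ col : ι → C, (∀ i, col i ∈ L i) ∧ ∀ i j, H.Adj i j → col i ≠ col j := by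
  classical
  suffices h : ∀ s : Finset ι, ∃ col : ι → C, (∀ i, col i ∈ L i) ∧
      ∀ i ∈ s, ∀ j ∈ s, H.Adj i j → col i ≠ col j by
    obtain ⟨col, h1, h2⟩ := h Finset.univ
    exact ⟨col, h1, fun i j => h2 i (Finset.mem_univ i) j (Finset.mem_univ j)⟩
  intro s
  induction s using Finset.induction_on with
  | empty =>
    have : ∀ i, ∃ c, c ∈ L i := fun i => Finset.card_pos.1 ((Nat.zero_le _).trans_lt (hL i))
    choose col hcol using this
    exact ⟨col, hcol, by simp⟩
  | insert a s ha ih =>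
    obtain ⟨col, h1, h2⟩ := ih
    obtain ⟨c, hc, hc'⟩ := Finset.exists_mem_notMem_of_card_lt_card
      (Finset.card_image_le.trans_lt (hL a) :
        ((Finset.univ.filter fun j => H.Adj a j).image col).card < (L a).card)
    have hfresh : ∀ j, H.Adj a j → col j ≠ c := fun j hj h =>
      hc' (Finset.mem_image.2 ⟨j, by simpa using hj, h⟩)
    refine ⟨Function.update col a c, fun i => ?_, fun i hi j hj hij => ?_⟩
    · rcases eq_or_ne i a with rfl | hi
      · simpa using hc
      · simpa [hi] using h1 i
    · rcases eq_or_ne i a with rfl | hia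
      · simpa [hij.ne'] using (hfresh j hij).symm
      · rcases eq_or_ne j a with rfl | hja
        · simpa [hia] using hfresh i hij.symm
        · simpa [hia, hja] using
            h2 i (Finset.mem_of_mem_insert_of_ne hi hia) j (Finset.mem_of_mem_insert_of_ne hj hja) hij

/-- A routing scheme towards three hubs. The vertex `v` may be routed to the hubs in `L v`, the
route to the hub `c` staying inside the edge set `A v c`; routes of distinct vertices are
edge-disjoint, except that `v` and its sibling `σ v ≠ v` must not be routed to the same hub. A
vertex with a sibling must have access to all hubs, any other vertex to two of them. Then demands
can be served by choosing for each of them a common hub of its two ends: two demands conflict only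
through a pair of siblings, so that every demand has more admissible hubs than conflicts. -/
theorem isKPathPairable_of_routes {V : Type*} [Fintype V] {G : SimpleGraph V}
    (hub : Fin 3 → V) (L : V → Finset (Fin 3)) (σ : V → V) (hσ : Function.Involutive σ)
    (hL : ∀ v, 2 ≤ (L v).card) (hLσ : ∀ v, σ v ≠ v → L v = Finset.univ)
    (A : V → Fin 3 → Set (Sym2 V))
    (hroute : ∀ v, ∀ c ∈ L v, ∃ p : G.Walk v (hub c), ∀ e ∈ p.edges, e ∈ A v c)
    (hA : ∀ v v' c c', c ∈ L v → c' ∈ L v' → v ≠ v' → (c = c' → v' ≠ σ v) →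
      Disjoint (A v c) (A v' c'))
    {k : ℕ} (hk : 2 * k ≤ Fintype.card V) : IsKPathPairable G k := by
  classical
  refine ⟨hk, fun x y hx hy hxy => ?_⟩
  have hxy' : ∀ i j, x i ≠ y j := fun i j h =>
    Set.disjoint_left.1 hxy ⟨i, rfl⟩ ⟨j, h.symm⟩
  -- The demands other than `i` that have the sibling of `v` as an end.
  let D : Fin k → V → Finset (Fin k) := fun i v =>
    Finset.univ.filter fun j => j ≠ i ∧ (x j = σ v ∨ y j = σ v)
  have hD1 : ∀ i v, (D i v).card ≤ 1 := by
    intro i v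
    rw [Finset.card_le_one]
    intro a ha b hb
    simp only [D, Finset.mem_filter, Finset.mem_univ, true_and] at ha hb
    rcases ha.2 with h | h <;> rcases hb.2 with h' | h'
    · exact hx (h.trans h'.symm)
    · exact absurd (h.trans h'.symm) (hxy' _ _)
    · exact absurd (h'.trans h.symm) (hxy' _ _)
    · exact hy (h.trans h'.symm)
  have hD : ∀ i v, (v = x i ∨ v = y i) → (D i v).card + 2 ≤ (L v).card := by
    intro i v hv
    by_cases hs : σ v = v
    · have : D i v = ∅ := by
        ext j
        simp only [D, Finset.mem_filter, Finset.mem_univ, true_and, hs, Finset.notMem_empty,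
          iff_false, not_and]
        rintro hji (h | h) <;> rcases hv with rfl | rfl
        · exact hji (hx h)
        · exact hxy' _ _ h
        · exact hxy' _ _ h.symm
        · exact hji (hy h)
      rw [this]
      simpa using hL v
    · rw [hLσ v hs]
      simpa using Nat.add_le_add_right (hD1 i v) 2
  let H : SimpleGraph (Fin k) :=
    { Adj := fun i j => j ∈ D i (x i) ∪ D i (y i)
      symm := ⟨fun i j h => by
        simp only [D, Finset.mem_union, Finset.mem_filter, Finset.mem_univ, true_and] at h ⊢
        rcases h with ⟨hne, h | h⟩ | ⟨hne, h | h⟩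
        · exact .inl ⟨hne.symm, .inl (by rw [h, hσ])⟩
        · exact .inr ⟨hne.symm, .inl (by rw [h, hσ])⟩
        · exact .inl ⟨hne.symm, .inr (by rw [h, hσ])⟩
        · exact .inr ⟨hne.symm, .inr (by rw [h, hσ])⟩⟩
      loopless := ⟨fun i h => by simp [D] at h⟩ }
  obtain ⟨col, hcol, hne⟩ := exists_list_coloring H (fun i => L (x i) ∩ L (y i)) (fun i => by
    have h1 := hD i (x i) (.inl rfl)
    have h2 := hD i (y i) (.inr rfl)
    have h3 := Finset.card_union_add_card_inter (L (x i)) (L (y i))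
    have h4 := Finset.card_le_univ (L (x i) ∪ L (y i))
    have h5 := Finset.card_union_le (D i (x i)) (D i (y i))
    have h6 : (Finset.univ.filter fun j => H.Adj i j) = D i (x i) ∪ D i (y i) := by
      ext j
      simp [H]
    rw [Fintype.card_fin] at h4
    rw [h6]
    omega)
  choose p hp using hroute
  have hcx : ∀ i, col i ∈ L (x i) := fun i => (Finset.mem_inter.1 (hcol i)).1
  have hcy : ∀ i, col i ∈ L (y i) := fun i => (Finset.mem_inter.1 (hcol i)).2
  let W : ∀ i, G.Walk (x i) (y i) := fun i =>
    (p (x i) (col i) (hcx i)).append (p (y i) (col i) (hcy i)).reverse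
  refine ⟨fun i => (W i).toPath, fun i j hij e hei hej => ?_⟩
  have hW : ∀ i, ∀ e ∈ (W i).edges, ∃ v, (v = x i ∨ v = y i) ∧ col i ∈ L v ∧ e ∈ A v (col i) := by
    intro i e he
    simp only [W, SimpleGraph.Walk.edges_append, SimpleGraph.Walk.edges_reverse, List.mem_append,
      List.mem_reverse] at he
    rcases he with he | he
    · exact ⟨_, .inl rfl, hcx i, hp _ _ _ e he⟩
    · exact ⟨_, .inr rfl, hcy i, hp _ _ _ e he⟩
  obtain ⟨v, hv, hvL, hve⟩ := hW i e ((W i).edges_toPath_subset_edges hei)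
  obtain ⟨w, hw, hwL, hwe⟩ := hW j e ((W j).edges_toPath_subset_edges hej)
  refine Set.disjoint_left.1 (hA v w _ _ hvL hwL ?_ ?_) hve hwe
  · rcases hv with rfl | rfl <;> rcases hw with rfl | rfl
    · exact fun h => hij (hx h)
    · exact hxy' _ _
    · exact (hxy' _ _).symm
    · exact fun h => hij (hy h)
  · intro hc hs
    refine hne i j ?_ hc
    have hmem : j ∈ D i v := by
      simp only [D, Finset.mem_filter, Finset.mem_univ, true_and]
      exact ⟨hij.symm, hw.imp (fun h => by rw [← h, hs]) (fun h => by rw [← h, hs])⟩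
    rcases hv with rfl | rfl
    · exact Finset.mem_union_left _ hmem
    · exact Finset.mem_union_right _ hmem

/-! ### Invariance under isomorphism -/

theorem IsPathPairable.of_iso {V W : Type*} [Fintype V] [Fintype W] {G : SimpleGraph V}
    {H : SimpleGraph W} (φ : G ≃g H) (hG : IsPathPairable G) : IsPathPairable H := by
  classical
  obtain ⟨k, hn, hk, hP⟩ := hG
  rw [Fintype.card_congr φ.toEquiv] at hn hk
  refine ⟨k, hn, hk, fun x y hx hy hxy => ?_⟩
  obtain ⟨x, rfl⟩ : ∃ x', x = φ ∘ x' := ⟨φ.symm ∘ x, by ext; simp⟩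
  obtain ⟨y, rfl⟩ : ∃ y', y = φ ∘ y' := ⟨φ.symm ∘ y, by ext; simp⟩
  obtain ⟨P, hdisj⟩ := hP x y hx.of_comp hy.of_comp (by
    rw [Set.disjoint_left] at hxy ⊢
    rintro _ ⟨i, rfl⟩ ⟨j, hj⟩
    exact hxy ⟨i, rfl⟩ ⟨j, congrArg φ hj⟩)
  refine ⟨fun i => (P i).map φ.toHom φ.injective, fun i j hij e hi hj => ?_⟩
  simp only [SimpleGraph.Path.map_coe, SimpleGraph.Walk.edges_map, List.mem_map] at hi hj
  obtain ⟨a, ha, rfl⟩ := hi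
  obtain ⟨b, hb, hab⟩ := hj
  obtain rfl := Sym2.map.injective φ.injective hab
  exact hdisj i j hij ha hb

/-! ### The extremal graph -/

/-- The vertices of the extremal graph: a tail of `q + 1` layers of `q + 1` vertices each, whose
positions are counted modulo `q + 1`; for every tail vertex a port; three hubs; and `f` further
vertices. -/
inductive HubVertex (q f : ℕ) : Type
  | tail (l : Fin (q + 1)) (p : ZMod (q + 1))
  | port (i : Fin (q + 1)) (j : ZMod (q + 1))
  | hub (c : Fin 3)
  | free (a : Fin f)

/-- The edges of the extremal graph. The tail vertex `j` of layer `i` owns a path through the tail,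
made of the edges `step l i j`, which `exit i j` joins to its port; the three edges `link i j c`
join that port to the hubs. The free vertices are joined to the first two hubs, and the hubs to
each other. -/
inductive HubEdge (q f : ℕ) : Type
  | step (l : Fin q) (i : Fin (q + 1)) (j : ZMod (q + 1))
  | exit (i : Fin (q + 1)) (j : ZMod (q + 1))
  | link (i : Fin (q + 1)) (j : ZMod (q + 1)) (c : Fin 3)
  | spoke (a : Fin f) (b : Fin 2)
  | rim (c : Fin 3)

namespace HubVertex

variable {q f : ℕ}

/-- `HubVertex q f` as a sum of product types. -/
def equivSum (q f : ℕ) : HubVertex q f ≃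
    (((Fin (q + 1) × ZMod (q + 1)) ⊕ (Fin (q + 1) × ZMod (q + 1))) ⊕ (Fin 3 ⊕ Fin f)) where
  toFun
    | tail l p => .inl (.inl (l, p))
    | port i j => .inl (.inr (i, j))
    | hub c => .inr (.inl c)
    | free a => .inr (.inr a)
  invFun
    | .inl (.inl x) => tail x.1 x.2
    | .inl (.inr x) => port x.1 x.2
    | .inr (.inl c) => hub c
    | .inr (.inr a) => free a
  left_inv v := by cases v <;> rfl
  right_inv v := by rcases v with (_ | _) | (_ | _) <;> rfl

instance : Fintype (HubVertex q f) := Fintype.ofEquiv _ (equivSum q f).symm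

theorem card_eq (q f : ℕ) : Fintype.card (HubVertex q f) = 2 * (q + 1) ^ 2 + 3 + f := by
  rw [Fintype.card_congr (equivSum q f)]
  simp only [Fintype.card_sum, Fintype.card_prod, Fintype.card_fin, ZMod.card]
  ring

end HubVertex

namespace HubEdge

open HubVertex

variable {q f : ℕ}

/-- `HubEdge q f` as a sum of product types. -/
def equivSum (q f : ℕ) : HubEdge q f ≃
    (((Fin q × Fin (q + 1) × ZMod (q + 1)) ⊕ (Fin (q + 1) × ZMod (q + 1))) ⊕
      ((Fin (q + 1) × ZMod (q + 1) × Fin 3) ⊕ ((Fin f × Fin 2) ⊕ Fin 3))) where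
  toFun
    | step l i j => .inl (.inl (l, i, j))
    | exit i j => .inl (.inr (i, j))
    | link i j c => .inr (.inl (i, j, c))
    | spoke a b => .inr (.inr (.inl (a, b)))
    | rim c => .inr (.inr (.inr c))
  invFun
    | .inl (.inl x) => step x.1 x.2.1 x.2.2
    | .inl (.inr x) => exit x.1 x.2
    | .inr (.inl x) => link x.1 x.2.1 x.2.2
    | .inr (.inr (.inl x)) => spoke x.1 x.2
    | .inr (.inr (.inr c)) => rim c
  left_inv v := by cases v <;> rfl
  right_inv v := by rcases v with (_ | _) | (_ | _ | _) <;> rfl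

theorem card_eq (q f : ℕ) :
    Nat.card (HubEdge q f) = (q + 1) ^ 3 + 3 * (q + 1) ^ 2 + 2 * f + 3 := by
  rw [Nat.card_congr (equivSum q f)]
  simp only [Nat.card_eq_fintype_card, Fintype.card_sum, Fintype.card_prod, Fintype.card_fin,
    ZMod.card]
  ring

/-- The position in layer `l` of the path owned by the vertex `j` of layer `i`. The path advances
by `i` in every step, so that two consecutive positions determine its owner. -/
def pos (i : Fin (q + 1)) (j : ZMod (q + 1)) (l : ℕ) : ZMod (q + 1) :=
  j + ((l : ZMod (q + 1)) - (i : ℕ)) * (i : ℕ)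

theorem pos_self (i : Fin (q + 1)) (j : ZMod (q + 1)) : pos i j i = j := by simp [pos]

theorem pos_succ (i : Fin (q + 1)) (j : ZMod (q + 1)) (l : ℕ) :
    pos i j (l + 1) = pos i j l + (i : ℕ) := by
  simp only [pos]; push_cast; ring

theorem owner_unique {i i' : Fin (q + 1)} {j j' : ZMod (q + 1)} {l : ℕ}
    (h : pos i j l = pos i' j' l) (h' : pos i j (l + 1) = pos i' j' (l + 1)) :
    i = i' ∧ j = j' := by
  rw [pos_succ, pos_succ, h, add_right_inj, ZMod.natCast_eq_natCast_iff',
    Nat.mod_eq_of_lt i.2, Nat.mod_eq_of_lt i'.2] at h'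
  obtain rfl := Fin.ext h'
  exact ⟨rfl, by simpa [pos] using h⟩

/-- The two ends of an edge of the extremal graph. -/
def ends : HubEdge q f → Sym2 (HubVertex q f)
  | step l i j => s(tail l.castSucc (pos i j l), tail l.succ (pos i j (l + 1)))
  | exit i j => s(tail (Fin.last q) (pos i j q), port i j)
  | link i j c => s(port i j, hub c)
  | spoke a b => s(free a, hub b.castSucc)
  | rim c => s(hub c, hub (c + 1))

theorem ends_injective : Function.Injective (ends : HubEdge q f → Sym2 (HubVertex q f)) := by
  have hrim : ∀ c c' : Fin 3, (c = c' ∧ c + 1 = c' + 1 ∨ c = c' + 1 ∧ c + 1 = c') → c = c' := by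
    decide
  intro e e' h
  cases e <;> cases e' <;>
    simp only [ends, Sym2.eq_iff, tail.injEq, port.injEq, hub.injEq, free.injEq, reduceCtorEq,
      and_false, false_and, or_false, step.injEq, exit.injEq, link.injEq,
      spoke.injEq, rim.injEq, Fin.castSucc_inj, Fin.succ_inj] at h ⊢
  case step.step l i j l' i' j' =>
    rcases h with ⟨⟨rfl, h1⟩, -, h2⟩ | ⟨⟨h1, -⟩, h2, -⟩
    · exact ⟨rfl, owner_unique h1 h2⟩
    · have h1 := congrArg Fin.val h1
      have h2 := congrArg Fin.val h2
      simp only [Fin.val_castSucc, Fin.val_succ] at h1 h2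
      omega
  case exit.exit => exact h.2
  case link.link => tauto
  case spoke.spoke => exact h
  case rim.rim => exact hrim _ _ h

end HubEdge

open HubVertex HubEdge

/-- The extremal graph: a long tail from which all vertices can be routed simultaneously to
distinct ports adjacent to three hubs. -/
def hubGraph (q f : ℕ) : SimpleGraph (HubVertex q f) :=
  SimpleGraph.fromEdgeSet (Set.range ends)

namespace hubGraph

variable {q f : ℕ}

theorem ncard_edgeSet_le (q f : ℕ) :
    (hubGraph q f).edgeSet.ncard ≤ (q + 1) ^ 3 + 3 * (q + 1) ^ 2 + 2 * f + 3 := by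
  have : Finite (HubEdge q f) := Finite.of_equiv _ (HubEdge.equivSum q f).symm
  rw [← HubEdge.card_eq, ← Set.ncard_univ]
  refine le_trans (Set.ncard_le_ncard ?_ (Set.toFinite _))
    (Set.ncard_image_le (f := ends) (Set.toFinite Set.univ))
  rw [hubGraph, SimpleGraph.edgeSet_fromEdgeSet, Set.image_univ]
  exact Set.sdiff_subset

theorem adj_of_ends_eq {e : HubEdge q f} {u v : HubVertex q f} (h : ends e = s(u, v))
    (huv : u ≠ v) : (hubGraph q f).Adj u v :=
  (SimpleGraph.fromEdgeSet_adj _).2 ⟨⟨e, h⟩, huv⟩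

/-- The depth of a vertex: its layer in the tail, continued to the ports, the hubs and the free
vertices. -/
def depth : HubVertex q f → ℕ
  | tail l _ => l
  | port _ _ => q + 1
  | hub _ => q + 2
  | free _ => q + 3

theorem depth_le_succ_of_adj {u v : HubVertex q f} (h : (hubGraph q f).Adj u v) :
    depth v ≤ depth u + 1 := by
  obtain ⟨⟨e, he⟩, -⟩ := (SimpleGraph.fromEdgeSet_adj _).1 h
  cases e <;> simp only [ends, Sym2.eq_iff] at he <;>
    rcases he with ⟨rfl, rfl⟩ | ⟨rfl, rfl⟩ <;> simp [depth] <;> omega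

theorem depth_le_of_walk {u v : HubVertex q f} (p : (hubGraph q f).Walk u v) :
    depth v ≤ depth u + p.length := by
  induction p with
  | nil => simp
  | cons h p ih =>
    have := depth_le_succ_of_adj h
    rw [SimpleGraph.Walk.length_cons]
    omega

theorem le_ediam (q f : ℕ) : ((q + 2 : ℕ) : ℕ∞) ≤ (hubGraph q f).ediam := by
  refine le_trans ?_ (SimpleGraph.edist_le_ediam (u := tail 0 0) (v := hub 0))
  refine le_iInf fun p => ?_
  have := depth_le_of_walk p
  simp only [depth, Fin.val_zero, zero_add] at this
  exact_mod_cast this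

/-- The involution exchanging every tail vertex with its port. -/
def sibling : HubVertex q f → HubVertex q f
  | tail l p => port l p
  | port i j => tail i j
  | hub c => hub c
  | free a => free a

/-- The hubs to which a vertex is routed. -/
def targets : HubVertex q f → Finset (Fin 3)
  | hub c => {c, c + 1}
  | free _ => {0, 1}
  | _ => Finset.univ

/-- Edges available for routing a vertex to a given hub. -/
def routeEdges : HubVertex q f → Fin 3 → Set (HubEdge q f)
  | tail i j, c => {e | (∃ l, e = step l i j) ∨ e = exit i j ∨ e = link i j c}
  | port i j, c => {e | e = link i j c}
  | hub h, _ => {e | e = rim h}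
  | free a, _ => {e | ∃ b, e = spoke a b}

theorem exists_walk_to_port (i : Fin (q + 1)) (j : ZMod (q + 1)) (l : Fin (q + 1)) :
    ∃ p : (hubGraph q f).Walk (tail l (pos i j l)) (port i j),
      ∀ e ∈ p.edges, ∃ e', ((∃ l, e' = step l i j) ∨ e' = exit i j) ∧ ends e' = e := by
  induction l using Fin.reverseInduction with
  | last =>
    refine ⟨(adj_of_ends_eq (e := exit i j) rfl (by simp)).toWalk, ?_⟩
    intro e he
    simp only [SimpleGraph.Walk.edges_cons, SimpleGraph.Walk.edges_nil, List.mem_singleton] at he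
    exact ⟨exit i j, .inr rfl, he.symm⟩
  | cast l ih =>
    obtain ⟨p, hp⟩ := ih
    refine ⟨.cons (adj_of_ends_eq (e := step l i j) rfl ?_) p, ?_⟩
    · simp [Fin.ext_iff]
    · intro e he
      rw [SimpleGraph.Walk.edges_cons, List.mem_cons] at he
      rcases he with rfl | he
      · exact ⟨step l i j, .inl ⟨l, rfl⟩, rfl⟩
      · exact hp e he

theorem exists_route (v : HubVertex q f) (c : Fin 3) (hc : c ∈ targets v) :
    ∃ p : (hubGraph q f).Walk v (hub c), ∀ e ∈ p.edges, e ∈ ends '' routeEdges v c := by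
  have hlink : ∀ (i : Fin (q + 1)) (j : ZMod (q + 1)),
      (hubGraph q f).Adj (port i j) (hub c) := fun i j =>
    adj_of_ends_eq (e := link i j c) rfl (by simp)
  cases v with
  | tail i j =>
    obtain ⟨p, hp⟩ := exists_walk_to_port (f := f) i j i
    have hpos := pos_self i j
    generalize pos i j i = x at p hpos
    subst hpos
    refine ⟨p.append (hlink i x).toWalk, fun e he => ?_⟩
    rw [SimpleGraph.Walk.edges_append, List.mem_append] at he
    rcases he with he | he
    · obtain ⟨e', he', rfl⟩ := hp e he
      exact ⟨e', he'.imp_right .inl, rfl⟩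
    · exact ⟨link i x c, .inr (.inr rfl), by simpa [ends, eq_comm] using he⟩
  | port i j =>
    refine ⟨(hlink i j).toWalk, fun e he => ⟨link i j c, rfl, ?_⟩⟩
    simpa [ends, eq_comm] using he
  | hub h =>
    simp only [targets, Finset.mem_insert, Finset.mem_singleton] at hc
    rcases hc with rfl | rfl
    · exact ⟨.nil, by simp⟩
    · have hadj : (hubGraph q f).Adj (hub h) (hub (h + 1)) :=
        adj_of_ends_eq (e := rim h) rfl (by revert h; simp)
      refine ⟨hadj.toWalk, fun e he => ⟨rim h, rfl, ?_⟩⟩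
      simpa [ends, eq_comm] using he
  | free a =>
    obtain ⟨b, rfl⟩ : ∃ b : Fin 2, b.castSucc = c := by
      clear hlink
      revert c
      simp only [targets]
      decide
    have hadj : (hubGraph q f).Adj (free a) (hub b.castSucc) :=
      adj_of_ends_eq (e := spoke a b) rfl (by simp)
    refine ⟨hadj.toWalk, fun e he => ⟨spoke a b, ⟨b, rfl⟩, ?_⟩⟩
    simpa [ends, eq_comm] using he

theorem isPathPairable (q f : ℕ) : IsPathPairable (hubGraph q f) := by
  refine ⟨Fintype.card (HubVertex q f) / 2, by omega, ?_⟩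
  refine isKPathPairable_of_routes hub targets sibling ?_ ?_ ?_
    (fun v c => ends '' routeEdges v c) exists_route ?_ (by omega)
  · intro v
    cases v <;> rfl
  · intro v
    cases v with
    | hub c => revert c; simp only [targets]; decide
    | _ => simp [targets]
  · intro v
    cases v <;> simp [sibling, targets]
  · intro v v' c c' _ _ hne hs
    rw [Set.disjoint_image_iff ends_injective, Set.disjoint_left]
    intro e he he'
    cases v <;> cases v' <;> simp only [routeEdges, Set.mem_ofPred_eq, sibling] at he he' hs hne <;>
      cases e <;> simp_all

end hubGraph

/-! ### The maximum diameter -/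

theorem exists_isPathPairable_le_ediam {n m q : ℕ} (hn : 2 * (q + 1) ^ 2 + 3 ≤ n)
    (hm : (q + 1) ^ 3 + 2 * n ≤ m + (q + 1) ^ 2 + 3) :
    ∃ G ∈ graphsWithAtMostEdges n m, IsPathPairable G ∧ ((q + 2 : ℕ) : ℕ∞) ≤ G.ediam := by
  obtain ⟨f, rfl⟩ := Nat.exists_eq_add_of_le hn
  let e : Fin (2 * (q + 1) ^ 2 + 3 + f) ≃ HubVertex q f :=
    (Fintype.equivFinOfCardEq (HubVertex.card_eq q f)).symm
  let φ : (hubGraph q f).comap e ≃g hubGraph q f := SimpleGraph.Iso.comap e _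
  refine ⟨(hubGraph q f).comap e, ?_, (hubGraph.isPathPairable q f).of_iso φ.symm, ?_⟩
  · have h := hubGraph.ncard_edgeSet_le q f
    have h' : ((hubGraph q f).comap e).edgeSet.ncard = (hubGraph q f).edgeSet.ncard :=
      Nat.card_congr φ.mapEdgeSet
    simp only [graphsWithAtMostEdges, Set.mem_ofPred_eq]
    rw [h']
    nlinarith
  · refine (hubGraph.le_ediam q f).trans (SimpleGraph.ediam_le_of_edist_le fun u v => ?_)
    refine le_trans (le_iInf fun p => ?_)
      (SimpleGraph.edist_le_ediam (u := φ.symm u) (v := φ.symm v))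
    have h := SimpleGraph.edist_le (p.map φ.toHom)
    rw [SimpleGraph.Walk.length_map] at h
    simpa using h

/-- The maximum exists as soon as there is a path-pairable graph in the family, and it is finite
since path-pairable graphs are connected. -/
theorem exists_isMaxDiameter {n : ℕ} {𝒢 : Set (SimpleGraph (Fin n))} {G₀ : SimpleGraph (Fin n)}
    (h₀ : G₀ ∈ 𝒢) (hG₀ : IsPathPairable G₀) :
    ∃ d : ℕ, IsMaxDiameter n 𝒢 d ∧ ∃ G ∈ 𝒢, IsPathPairable G ∧ G.ediam = d := by
  obtain ⟨G, ⟨hG, hGp⟩, hmax⟩ := Set.exists_max_image {G | G ∈ 𝒢 ∧ IsPathPairable G}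
    (fun G => G.ediam) (Set.toFinite _) ⟨G₀, h₀, hG₀⟩
  have hfin : G.ediam ≠ ⊤ := by
    rcases isEmpty_or_nonempty (Fin n) with _ | _
    · rw [SimpleGraph.ediam_eq_zero_of_subsingleton]
      exact ENat.zero_ne_top
    · exact SimpleGraph.connected_iff_ediam_ne_top.1 ⟨hGp.preconnected⟩
  have hd : G.ediam = (G.ediam.toNat : ℕ) := (ENat.natCast_toNat hfin).symm
  refine ⟨G.ediam.toNat, ⟨⟨G, hG, hGp, hd⟩, ?_⟩, G, hG, hGp, hd⟩
  rintro _ ⟨G', hG', hGp', rfl⟩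
  rw [← hd]
  exact hmax G' ⟨hG', hGp'⟩

theorem IsPathPairable.ediam_cube_le {V : Type*} [Fintype V] {G : SimpleGraph V}
    (hG : IsPathPairable G) {d : ℕ} (hd : G.ediam = d) : d ^ 3 ≤ 384 * G.edgeSet.ncard := by
  rcases isEmpty_or_nonempty V with _ | _
  · rw [SimpleGraph.ediam_eq_zero_of_subsingleton] at hd
    obtain rfl : 0 = d := by exact_mod_cast hd
    simp
  · obtain ⟨u, v, huv⟩ := G.exists_edist_eq_ediam_of_finite
    have h := hG.dist_cube_le u v
    rwa [SimpleGraph.dist, huv, hd, ENat.toNat_natCast] at h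

/-- The number of layers needed for a diameter of at least `(m / 2 - n) ^ (1 / 3)` fits into `n`
vertices and `m` edges. -/
theorem exists_number_of_layers {n m : ℕ} (hn : 0 < n) (h₁ : 2 * n ≤ m)
    (h₂ : (m : ℝ) ≤ (1 / 4 : ℝ) * (n : ℝ) ^ (3 / 2 : ℝ)) :
    ∃ q : ℕ, 2 * (q + 1) ^ 2 + 3 ≤ n ∧ (q + 1) ^ 3 + 2 * n ≤ m + (q + 1) ^ 2 + 3 ∧
      ((1 / 2 : ℝ) * (m : ℝ) - (n : ℝ)) ^ (1 / 3 : ℝ) ≤ ((q + 2 : ℕ) : ℝ) := by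
  have hnR : (0 : ℝ) < n := by exact_mod_cast hn
  have h₁R : (2 : ℝ) * n ≤ m := by exact_mod_cast h₁
  set s : ℝ := √n with hs
  have hs0 : 0 < s := Real.sqrt_pos.2 hnR
  have hs2 : s ^ 2 = n := Real.sq_sqrt hnR.le
  have hs3 : (n : ℝ) ^ (3 / 2 : ℝ) = s ^ 3 := by
    rw [hs, Real.sqrt_eq_rpow, ← Real.rpow_natCast, ← Real.rpow_mul hnR.le]
    norm_num
  rw [hs3] at h₂
  have hs8 : 8 ≤ s := by
    have : 8 * s ^ 2 ≤ s * s ^ 2 := by nlinarith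
    exact le_of_mul_le_mul_right this (by positivity)
  have hn64 : (64 : ℝ) ≤ n := by nlinarith
  have hx0 : (0 : ℝ) ≤ (1 / 2 : ℝ) * m - n := by linarith
  set D : ℝ := ((1 / 2 : ℝ) * (m : ℝ) - (n : ℝ)) ^ (1 / 3 : ℝ) with hD
  have hD0 : 0 ≤ D := Real.rpow_nonneg hx0 _
  have hD3 : D ^ 3 = (1 / 2 : ℝ) * m - n := by
    rw [hD, ← Real.rpow_natCast, ← Real.rpow_mul hx0]
    norm_num
  have hDs : D ≤ s / 2 := by
    refine le_of_pow_le_pow_left₀ (n := 3) (by norm_num) (by positivity) ?_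
    rw [hD3, div_pow]
    linarith
  by_cases hD2 : D ≤ 2
  · refine ⟨0, ?_, by omega, by simpa using hD2⟩
    have : 64 ≤ n := by exact_mod_cast hn64
    omega
  · push Not at hD2
    -- With `q = ⌈D⌉ - 2` the number `q + 1` of layers is still smaller than `D`.
    obtain ⟨q, hq⟩ : ∃ q, ⌈D⌉₊ = q + 2 :=
      Nat.exists_eq_add_of_le' (Nat.lt_ceil.2 (by exact_mod_cast one_lt_two.trans hD2))
    have hqD : ((q + 1 : ℕ) : ℝ) < D := Nat.lt_ceil.1 (by omega)
    have hDq : D ≤ ((q + 2 : ℕ) : ℝ) := hq ▸ Nat.le_ceil D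
    have hsq : ((q + 1 : ℕ) : ℝ) ^ 2 ≤ D ^ 2 := by gcongr
    have hcu : ((q + 1 : ℕ) : ℝ) ^ 3 ≤ D ^ 3 := by gcongr
    refine ⟨q, ?_, ?_, hDq⟩
    · have : (2 : ℝ) * ((q + 1 : ℕ) : ℝ) ^ 2 + 3 ≤ n := by nlinarith
      exact_mod_cast this
    · have : 2 * ((q + 1 : ℕ) : ℝ) ^ 3 + 2 * n ≤ m := by linarith
      have : 2 * (q + 1) ^ 3 + 2 * n ≤ m := by exact_mod_cast this
      omega

theorem theorem1 (n m : ℕ) (h₁ : 2 * n ≤ m)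
    (h₂ : (m : ℝ) ≤ (1 / 4 : ℝ) * (n : ℝ) ^ (3 / 2 : ℝ)) :
    ∃ d : ℕ, IsMaxDiameter n (graphsWithAtMostEdges n m) d ∧
      ((1 / 2 : ℝ) * (m : ℝ) - (n : ℝ)) ^ (1 / 3 : ℝ) ≤ (d : ℝ) ∧
      (d : ℝ) ≤ 16 * (m : ℝ) ^ (1 / 3 : ℝ) := by
  obtain ⟨G₀, hG₀, hp₀, hd₀⟩ : ∃ G₀ ∈ graphsWithAtMostEdges n m, IsPathPairable G₀ ∧
      ∀ d : ℕ, G₀.ediam ≤ d → ((1 / 2 : ℝ) * (m : ℝ) - (n : ℝ)) ^ (1 / 3 : ℝ) ≤ (d : ℝ) := by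
    rcases Nat.eq_zero_or_pos n with rfl | hn
    · -- Here also `m = 0`, and the graph without vertices has diameter `0`.
      have hm : (m : ℝ) = 0 := le_antisymm (by simpa using h₂) (Nat.cast_nonneg m)
      refine ⟨⊥, by simp [graphsWithAtMostEdges], ⟨0, by simp, by simp, fun _ _ _ _ _ =>
        ⟨fun i => i.elim0, fun i => i.elim0⟩⟩, fun d _ => ?_⟩
      simp [hm]
    · obtain ⟨q, hq1, hq2, hq3⟩ := exists_number_of_layers hn h₁ h₂
      obtain ⟨G, hG, hp, hd⟩ := exists_isPathPairable_le_ediam hq1 hq2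
      refine ⟨G, hG, hp, fun d hGd => hq3.trans ?_⟩
      exact_mod_cast hd.trans hGd
  obtain ⟨d, hmax, G, hG, hp, hGd⟩ := exists_isMaxDiameter hG₀ hp₀
  refine ⟨d, hmax, hd₀ d (hmax.2 ⟨G₀, hG₀, hp₀, rfl⟩), ?_⟩
  have hcube : d ^ 3 ≤ 384 * m := (hp.ediam_cube_le hGd).trans (Nat.mul_le_mul_left _ hG)
  have hcubeR : (d : ℝ) ^ 3 ≤ 384 * m := by exact_mod_cast hcube
  refine le_of_pow_le_pow_left₀ (n := 3) (by norm_num) (by positivity) ?_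
  have h3 : ((m : ℝ) ^ (1 / 3 : ℝ)) ^ 3 = m := by
    rw [← Real.rpow_natCast, ← Real.rpow_mul (Nat.cast_nonneg m)]
    norm_num
  rw [mul_pow, h3]
  have : (0 : ℝ) ≤ m := Nat.cast_nonneg m
  linarith
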